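/- **Definitions.** A register automaton over the rationals ($\mathrm{RA}_{\mathbb Q}$) with control variables $X=\{x_1,\dots,x_k\}$ and data variables $Y=\{y_1,\dots,y_l\}$ ($k,l\ge 0$) is a tuple $\mathcal A=\langle Q,q_0,F,\mathbf u_0,\delta,\zeta\rangle$, where $Q$ is a finite set of states, $q_0\in Q$ is the initial state, $F\subseteq Q$ is the set of final states, $\mathbf u_0\in\mathbb Q^{k+l}$ gives the initial contents of the variables, and $\zeta$ maps each final state to a linear expression $\mathbf a\cdot\mathbf x+\mathbf b\cdot\mathbf y+c$ with rational coefficients. Finally, $\delta$ is a finite set of transitions $(p,\varphi)\to(q,A,B,\mathbf b)$. Here $p,q\in Q$; the guard $\varphi$ is a Boolean combination of atoms $z\le z'$ with $z,z'\in X\cup\{\mathrm{cur}\}$; $A$ is a 0-1 matrix of size $k\times(k+1)$ with exactly one $1$ in each row (a map $X\to X\cup\{\mathrm{cur}\}$); $B\in\mathbb Q^{l\times(k+l+1)}$; and $\mathbf b\in\mathbb Q^l$. If $\mathcal A$ is in state $p$ with control contents $\mathbf u$ and data contents $\mathbf v$ and reads $d\in\mathbb Q$, it may take this transition if $\varphi(\mathbf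 u,d)$ holds; it then moves to $q$, and the new contents are $A\binom{\mathbf u}{d}$ and $B\left(\begin{smallmatrix}\mathbf u\\ \mathbf v\\ d\end{smallmatrix}\right)+\mathbf b$. For a word $w=d_1\cdots d_m\in\mathbb Q^*$, $\mathcal A(w)\subseteq\mathbb Q$ is the set of the values of $\zeta(q)$ at the final contents of the variables, over all runs of $\mathcal A$ on $w$ that start in $(q_0,\mathbf u_0)$ and end in some $q\in F$. $\mathcal A$ is *deterministic* if for any two different transitions that start in the same state, with guards $\varphi$ and $\varphi'$, the formula $\varphi\wedge\varphi'$ is unsatisfiable over $\mathbb Q$. The *reachability problem* is: given an $\mathrm{RA}_{\mathbb Q}$ $\mathcal A$ (as a finite object, with rationals written as fractions), decide whether there is a word $w\in\mathbb Q^*$ with $0\in\mathcal A(w)$. **Theorem.** The reachability problem for $\mathrm{RA}_{\mathbb Q}$ is undecidable, even for deterministic $\mathrm{RA}_{\mathbb Q}$: there is no algorithm that decides it for all $\mathrm{RA}_{\mathbb Q}$, and there is not even an algorithm that halts with the correct answer on every deterministic $\mathrm{RA}_{\mathbb Q}$ (with arbitrary behaviour on other inputs). -/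

import Mathlib

/-- Linear constraints over `X ∪ {cur}` with `X = {x₁, …, x_k}`: Boolean combinations of atoms
`z ≤ z'`.  The variable `cur` is `none` and the control variable `x_i` is `some i`. -/
inductive Guard (k : ℕ) : Type
  | le (z z' : Option (Fin k)) : Guard k
  | neg (φ : Guard k) : Guard k
  | conj (φ ψ : Guard k) : Guard k
  | disj (φ ψ : Guard k) : Guard k

/-- The value of a variable of `X ∪ {cur}` when the control variables contain `x` and the data
value currently read is `d`. -/
def controlVal {k : ℕ} (x : Fin k → ℚ) (d : ℚ) (z : Option (Fin k)) : ℚ :=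
  z.elim d x

/-- The constraint holds when the control variables contain `x` and `cur = d`. -/
def Guard.Holds {k : ℕ} (x : Fin k → ℚ) (d : ℚ) : Guard k → Prop
  | .le z z' => controlVal x d z ≤ controlVal x d z'
  | .neg φ => ¬ φ.Holds x d
  | .conj φ ψ => φ.Holds x d ∧ ψ.Holds x d
  | .disj φ ψ => φ.Holds x d ∨ ψ.Holds x d

/-- A transition `(p, φ(x, cur)) → (q, A, B, b)` over `k` control and `l` data variables, with
states in `Fin n`.  A `k × (k+1)` 0-1 matrix `A` with exactly one `1` in each row is given as the
map from `{x₁, …, x_k}` to `{x₁, …, x_k, cur}` that it denotes.  The columns of `B` are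
indexed by the control variables, the data variables and `cur`. -/
structure RAQTransition (k l n : ℕ) : Type where
  /-- the state in which the transition starts -/
  src : Fin n
  /-- the guard -/
  guard : Guard k
  /-- the state in which the transition ends -/
  tgt : Fin n
  /-- the reassignment of the control variables -/
  A : Fin k → Option (Fin k)
  /-- the linear part of the reassignment of the data variables -/
  B : Matrix (Fin l) (Fin k ⊕ Fin l ⊕ Unit) ℚ
  /-- the constant part of the reassignment of the data variables -/
  b : Fin l → ℚ

/-- A linear expression `a · x + b · y + c`. -/
structure OutputExpr (k l : ℕ) : Type where
  a : Fin k → ℚ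
  b : Fin l → ℚ
  c : ℚ

/-- The value of a linear expression at given contents of the variables. -/
def OutputExpr.eval {k l : ℕ} (g : OutputExpr k l) (x : Fin k → ℚ) (y : Fin l → ℚ) : ℚ :=
  g.a ⬝ᵥ x + g.b ⬝ᵥ y + g.c

/-- Register automata over the rationals.  The finite set of transitions is given by a list of
its elements; nothing below but the encoding depends on the order or on repetitions. -/
structure RAQ : Type where
  /-- number of control variables -/
  k : ℕ
  /-- number of data variables -/
  l : ℕ
  /-- number of states -/
  n : ℕ
  /-- initial state -/
  q₀ : Fin n
  /-- final states -/
  F : Finset (Fin n)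
  /-- initial contents of the control variables -/
  x₀ : Fin k → ℚ
  /-- initial contents of the data variables -/
  y₀ : Fin l → ℚ
  /-- transitions -/
  δ : List (RAQTransition k l n)
  /-- output expression of each final state -/
  ζ : {q : Fin n // q ∈ F} → OutputExpr k l

namespace RAQ

/-- A configuration: a state with the contents of the control and of the data variables. -/
structure Config (𝒜 : RAQ) : Type where
  state : Fin 𝒜.n
  x : Fin 𝒜.k → ℚ
  y : Fin 𝒜.l → ℚ

/-- The initial configuration. -/
def init (𝒜 : RAQ) : 𝒜.Config := ⟨𝒜.q₀, 𝒜.x₀, 𝒜.y₀⟩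

/-- The relation `C ⊢_{t,d} C'`. -/
def Step (𝒜 : RAQ) (t : RAQTransition 𝒜.k 𝒜.l 𝒜.n) (d : ℚ) (C C' : 𝒜.Config) : Prop :=
  C.state = t.src ∧ t.guard.Holds C.x d ∧ C'.state = t.tgt ∧
    C'.x = (fun i => controlVal C.x d (t.A i)) ∧
    C'.y = t.B.mulVec (Sum.elim C.x (Sum.elim C.y (fun _ => d))) + t.b

/-- `𝒜.Run C w C'`: reading the word `w`, the automaton can go from `C` to `C'`. -/
inductive Run (𝒜 : RAQ) : 𝒜.Config → List ℚ → 𝒜.Config → Prop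
  | nil (C : 𝒜.Config) : Run 𝒜 C [] C
  | cons {C C' C'' : 𝒜.Config} {t : RAQTransition 𝒜.k 𝒜.l 𝒜.n} {d : ℚ} {w : List ℚ} :
      t ∈ 𝒜.δ → 𝒜.Step t d C C' → Run 𝒜 C' w C'' → Run 𝒜 C (d :: w) C''

/-- The set `𝒜(w)` of all outputs of `𝒜` on the word `w`. -/
def outputs (𝒜 : RAQ) (w : List ℚ) : Set ℚ :=
  {r | ∃ C : 𝒜.Config, 𝒜.Run 𝒜.init w C ∧
    ∃ h : C.state ∈ 𝒜.F, r = (𝒜.ζ ⟨C.state, h⟩).eval C.x C.y}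

/-- The guards of two different transitions starting in the same state are never satisfied
together. -/
def Deterministic (𝒜 : RAQ) : Prop :=
  ∀ t ∈ 𝒜.δ, ∀ t' ∈ 𝒜.δ, t ≠ t' → t.src = t'.src →
    ¬ ∃ (x : Fin 𝒜.k → ℚ) (d : ℚ), t.guard.Holds x d ∧ t'.guard.Holds x d

/-- The property asked for by the reachability problem: some word has `0` among its outputs. -/
def OutputsZero (𝒜 : RAQ) : Prop :=
  ∃ w : List ℚ, (0 : ℚ) ∈ 𝒜.outputs w

end RAQ

/-! ### Automata as inputs of algorithms -/

/-- Codes of rationals: numerator and (positive) denominator in lowest terms. -/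
abbrev RatCode : Type := ℤ × ℕ

/-- The code of a rational. -/
def ratCode (r : ℚ) : RatCode := (r.num, r.den)

/-- The code of a vector of rationals: the list of the codes of its entries. -/
def vecCode {m : ℕ} (v : Fin m → ℚ) : List RatCode := List.ofFn fun i => ratCode (v i)

/-- The code of a variable: `0` for `cur` and `i + 1` for the control variable with index `i`. -/
def varCode {k : ℕ} (z : Option (Fin k)) : ℕ := z.elim 0 fun i => (i : ℕ) + 1

/-- A guard is written in prefix notation. -/
def Guard.code {k : ℕ} : Guard k → List ℕ
  | .le z z' => [0, varCode z, varCode z']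
  | .neg φ => 1 :: φ.code
  | .conj φ ψ => 2 :: (φ.code ++ ψ.code)
  | .disj φ ψ => 3 :: (φ.code ++ ψ.code)

/-- Codes of transitions: source, guard, target, `A`, rows of `B`, and `b`. -/
abbrev TransitionCode : Type :=
  ℕ × List ℕ × ℕ × List ℕ × List (List RatCode × List RatCode × RatCode) × List RatCode

/-- The code of a transition. -/
def RAQTransition.code {k l n : ℕ} (t : RAQTransition k l n) : TransitionCode :=
  (t.src, t.guard.code, t.tgt, List.ofFn fun i => varCode (t.A i),
    List.ofFn fun i => (vecCode fun j => t.B i (.inl j), vecCode fun j => t.B i (.inr (.inl j)),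
      ratCode (t.B i (.inr (.inr ())))),
    vecCode t.b)

/-- Codes of linear expressions. -/
abbrev OutputCode : Type := List RatCode × List RatCode × RatCode

/-- The code of a linear expression: its coefficients and its constant. -/
def OutputExpr.code {k l : ℕ} (g : OutputExpr k l) : OutputCode :=
  (vecCode g.a, vecCode g.b, ratCode g.c)

/-- Codes of automata: `k`, `l`, `n`, initial state, initial contents, transitions, and for each
state its output expression if it is final. -/
abbrev RAQCode : Type :=
  ℕ × ℕ × ℕ × ℕ × List RatCode × List RatCode × List TransitionCode × List (Option OutputCode)

/-- The code of an automaton. -/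
def RAQ.code (𝒜 : RAQ) : RAQCode :=
  (𝒜.k, 𝒜.l, 𝒜.n, 𝒜.q₀, vecCode 𝒜.x₀, vecCode 𝒜.y₀, 𝒜.δ.map RAQTransition.code,
    List.ofFn fun q => if h : q ∈ 𝒜.F then some (𝒜.ζ ⟨q, h⟩).code else none)

theorem ratCode_inj : Function.Injective ratCode := by
  intro a b h
  simp only [ratCode, Prod.mk.injEq] at h
  exact Rat.ext h.1 h.2

theorem vecCode_inj {m : ℕ} : Function.Injective (vecCode (m := m)) := by
  intro a b h
  have := List.ofFn_injective h
  funext i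
  exact ratCode_inj (congrFun this i)

theorem varCode_inj {k : ℕ} : Function.Injective (varCode (k := k)) := by
  intro a b h
  cases a <;> cases b <;> simp_all [varCode, Fin.ext_iff]

/-- The prefix notation of guards can be parsed in one way only. -/
theorem Guard.code_app {k : ℕ} (φ ψ : Guard k) (r s : List ℕ) (h : φ.code ++ r = ψ.code ++ s) :
    φ = ψ ∧ r = s := by
  induction φ generalizing ψ r s with
  | le z z' =>
    cases ψ <;> simp [Guard.code] at h
    obtain ⟨h1, h2, h3⟩ := h
    simp [varCode_inj h1, varCode_inj h2, h3]
  | neg φ ih =>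
    cases ψ <;> simp [Guard.code] at h
    have := ih _ _ _ h
    simp [this]
  | conj φ φ' ih ih' =>
    cases ψ <;> simp [Guard.code] at h
    obtain ⟨h1, h2⟩ := ih _ _ _ h
    obtain ⟨h3, h4⟩ := ih' _ _ _ h2
    simp [*]
  | disj φ φ' ih ih' =>
    cases ψ <;> simp [Guard.code] at h
    obtain ⟨h1, h2⟩ := ih _ _ _ h
    obtain ⟨h3, h4⟩ := ih' _ _ _ h2
    simp [*]

theorem RAQTransition.code_inj {k l n : ℕ} :
    Function.Injective (RAQTransition.code (k := k) (l := l) (n := n)) := by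
  rintro ⟨s, g, t, A, B, b⟩ ⟨s', g', t', A', B', b'⟩ h
  simp only [RAQTransition.code, Prod.mk.injEq] at h
  obtain ⟨h1, h2, h3, h4, h5, h6⟩ := h
  have e2 := (Guard.code_app g g' [] [] (by simpa using h2)).1
  have e4 : A = A' := funext fun i => varCode_inj (congrFun (List.ofFn_injective h4) i)
  have e5 : B = B' := by
    ext i j
    have := congrFun (List.ofFn_injective h5) i
    simp only [Prod.mk.injEq] at this
    rcases j with j | j | j
    · exact congrFun (vecCode_inj this.1) j
    · exact congrFun (vecCode_inj this.2.1) j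
    · exact ratCode_inj this.2.2
  have e1 := Fin.ext h1
  have e3 := Fin.ext h3
  have e6 := vecCode_inj h6
  simp only [*]

theorem OutputExpr.code_inj {k l : ℕ} : Function.Injective (OutputExpr.code (k := k) (l := l)) := by
  rintro ⟨a, b, c⟩ ⟨a', b', c'⟩ h
  simp only [OutputExpr.code, Prod.mk.injEq] at h
  simp only [vecCode_inj h.1, vecCode_inj h.2.1, ratCode_inj h.2.2]

/-- Different automata have different codes. -/
theorem RAQ.code_inj : Function.Injective RAQ.code := by
  rintro ⟨k, l, n, q, F, x, y, δ, ζ⟩ ⟨k', l', n', q', F', x', y', δ', ζ'⟩ h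
  simp only [RAQ.code, Prod.mk.injEq] at h
  obtain ⟨rfl, rfl, rfl, h1, h2, h3, h4, h5⟩ := h
  have e5 := List.ofFn_injective h5
  have e1 := Fin.ext h1
  have e2 := vecCode_inj h2
  have e3 := vecCode_inj h3
  have e4 := (List.map_injective_iff.2 RAQTransition.code_inj) h4
  have eF : F = F' := by
    ext p
    have := congrFun e5 p
    by_cases hp : p ∈ F <;> by_cases hp' : p ∈ F' <;> simp_all
  subst eF
  have eζ : ζ = ζ' := by
    funext ⟨p, hp⟩
    have := congrFun e5 p
    simp only [hp, dite_true, Option.some.injEq] at this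
    exact OutputExpr.code_inj this
  simp only [*]

/-- The problem "given an automaton in the class `𝒞`, decide whether it has the property `P`" is
decidable: some algorithm, started on the code of any automaton in `𝒞`, halts with the right
answer.  Nothing is required of the algorithm on other inputs. -/
def RAQ.DecidableOn (𝒞 P : RAQ → Prop) : Prop :=
  ∃ f : RAQCode →. Bool, Partrec f ∧
    ∀ 𝒜 : RAQ, 𝒞 𝒜 → ∃ b ∈ f 𝒜.code, (b = true ↔ P 𝒜)

/-! The halting problem is reduced to reachability. A fixed universal Turing machine
(`exists_universal_TM0`) is simulated by a Post normal system, whose steps `u w ⇒ w v` remove a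
prefix and append a suffix (`exists_postSystem`). A word `W` over an alphabet numbered by digits
below `p` is stored in two data variables: `y` is its value in base `p`, first letter least
significant, and `z = p ^ |W|`. Then `u w ⇒ w v` becomes the affine update `y ↦ (y - val u) / p^|u|
+ (z / p^|u|) · val v`, `z ↦ z · p^|v| / p^|u|`.

Nothing tests whether `W` really starts with `u`. Instead, a wrong guess is fatal. The output can
only become `0` by subtracting `1` repeatedly in the second state, so `y` was an integer there.
Since rules never shorten words and words are at least as long as every left side, integrality
propagates backwards through all moves: `y` was an integer at every earlier time. Integrality of `(y
- val u) / p^|u|` means `y ≡ val u` modulo `p^|u|`, that is, the word did start with `u`. This is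
`postMoves_sound`; `postMoves_complete` is the easy converse.

Such an affine system is run by a deterministic register automaton, because the choice of the move
is left to the input word: control variables hold fixed thresholds, and the interval that contains
the letter selects the transition (`affineRAQ_deterministic`, `affineRAQ_outputsZero_iff`). Only the
initial data contents depend on the program whose halting is asked, so the reduction is computable
(`exists_computable_reduction`). -/

/-! ### Affine systems as deterministic register automata -/

/-- A transition of a two-variable affine system with two states: from `src` to `tgt`, replacing
`(y, z)` by `(α y + β z + γ, μ z)`. -/
structure AffineMove : Type where
  src : Fin 2
  tgt : Fin 2
  α : ℚ
  β : ℚ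
  γ : ℚ
  μ : ℚ

/-- A configuration of a two-variable affine system. -/
abbrev AffineConfig : Type := Fin 2 × ℚ × ℚ

/-- One move of an affine system. -/
def AffineStep (T : List AffineMove) (c c' : AffineConfig) : Prop :=
  ∃ t ∈ T, c.1 = t.src ∧ c' = (t.tgt, t.α * c.2.1 + t.β * c.2.2 + t.γ, t.μ * c.2.2)

/-- The guard expressing that `i` is the first index with `cur ≤ x_i`. -/
def selectGuard {k : ℕ} (i : Fin k) : Guard k :=
  ((List.finRange k).filter (· < i)).foldr
    (fun j φ => .conj (.neg (.le none (some j))) φ) (.le none (some i))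

theorem selectGuard_holds {k : ℕ} (i : Fin k) (x : Fin k → ℚ) (d : ℚ) :
    (selectGuard i).Holds x d ↔ d ≤ x i ∧ ∀ j < i, ¬ d ≤ x j := by
  have key : ∀ l : List (Fin k),
      (l.foldr (fun j φ => Guard.conj (.neg (.le none (some j))) φ) (.le none (some i))).Holds x d ↔
        d ≤ x i ∧ ∀ j ∈ l, ¬ d ≤ x j := by
    intro l
    induction l with
    | nil => simp [Guard.Holds, controlVal]
    | cons a l ih =>
      rw [List.foldr_cons, Guard.Holds, ih]
      simp only [Guard.Holds, controlVal, Option.elim, List.forall_mem_cons]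
      tauto
  rw [selectGuard, key]
  simp

/-- The `i`-th transition of the automaton of an affine system with `k` moves. -/
def AffineMove.toTransition {k : ℕ} (t : AffineMove) (i : Fin k) : RAQTransition k 2 2 where
  src := t.src
  guard := selectGuard i
  tgt := t.tgt
  A := some
  B := Matrix.of fun r => Sum.elim 0 (Sum.elim (!![t.α, t.β; 0, t.μ] r) 0)
  b := ![t.γ, 0]

/-- The register automaton of an affine system.  The control variables hold the constants
`0, …, k - 1`, and the letter that is read chooses the move. -/
def affineRAQ (T : List AffineMove) (y z : ℚ) : RAQ where
  k := T.length
  l := 2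
  n := 2
  q₀ := 0
  F := {1}
  x₀ := fun i => (i : ℕ)
  y₀ := ![y, z]
  δ := List.ofFn fun i : Fin T.length => T[i].toTransition i
  ζ := fun _ => ⟨0, ![1, 0], 0⟩

/-- A first index is unique for any contents of the control variables. This matters because
determinism quantifies over all contents, not only over the constants `0, …, k - 1` that occur in
runs. -/
theorem affineRAQ_deterministic (T : List AffineMove) (y z : ℚ) :
    (affineRAQ T y z).Deterministic := by
  intro t ht t' ht' hne _ ⟨x, d, h, h'⟩
  obtain ⟨i, rfl⟩ := (List.mem_ofFn' _ _).1 ht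
  obtain ⟨j, rfl⟩ := (List.mem_ofFn' _ _).1 ht'
  replace h := (selectGuard_holds i x d).1 h
  replace h' := (selectGuard_holds j x d).1 h'
  rcases lt_trichotomy i j with hij | rfl | hij
  · exact h'.2 i hij h.1
  · exact hne rfl
  · exact h.2 j hij h'.1

/-- A configuration of an affine system as one of its automaton. -/
def affineConfig (T : List AffineMove) (y z : ℚ) (c : AffineConfig) : (affineRAQ T y z).Config :=
  ⟨c.1, fun i => (i : ℕ), ![c.2.1, c.2.2]⟩

theorem affineRAQ_step_iff (T : List AffineMove) (y z : ℚ) (i : Fin T.length) (d : ℚ)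
    (c : AffineConfig) (C : (affineRAQ T y z).Config) :
    (affineRAQ T y z).Step (T[i].toTransition i) d (affineConfig T y z c) C ↔
      c.1 = T[i].src ∧ (selectGuard i).Holds (fun i : Fin T.length => ((i : ℕ) : ℚ)) d ∧
        C = affineConfig T y z (T[i].tgt, T[i].α * c.2.1 + T[i].β * c.2.2 + T[i].γ,
          T[i].μ * c.2.2) := by
  have hB : (T[i].toTransition i).B.mulVec (Sum.elim (fun i : Fin T.length => ((i : ℕ) : ℚ))
      (Sum.elim ![c.2.1, c.2.2] fun _ => d)) + (T[i].toTransition i).b =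
      ![T[i].α * c.2.1 + T[i].β * c.2.2 + T[i].γ, T[i].μ * c.2.2] := by
    ext r
    fin_cases r <;>
      simp [AffineMove.toTransition, Matrix.mulVec, dotProduct, Fin.sum_univ_two]
  obtain ⟨s, x, v⟩ := C
  constructor
  · rintro ⟨h1, h2, h3, h4, h5⟩
    refine ⟨h1, h2, ?_⟩
    have h5' := h5.trans hB
    simp only at h3 h4 h5'
    subst h3 h4 h5'
    rfl
  · rintro ⟨h1, h2, h3⟩
    cases h3
    exact ⟨h1, h2, rfl, rfl, hB.symm⟩

theorem affineRAQ_run_iff (T : List AffineMove) (y z : ℚ) (c : AffineConfig)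
    (C : (affineRAQ T y z).Config) :
    (∃ w, (affineRAQ T y z).Run (affineConfig T y z c) w C) ↔
      ∃ c', C = affineConfig T y z c' ∧ Relation.ReflTransGen (AffineStep T) c c' := by
  constructor
  · rintro ⟨w, h⟩
    generalize hD : affineConfig T y z c = D at h
    induction h generalizing c with
    | nil => exact ⟨c, hD.symm, .refl⟩
    | cons ht hs _ ih =>
      subst hD
      obtain ⟨i, rfl⟩ := (List.mem_ofFn' _ _).1 ht
      obtain ⟨h1, -, h2⟩ := (affineRAQ_step_iff T y z i _ c _).1 hs
      obtain ⟨c', hc', hr⟩ := ih _ h2.symm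
      exact ⟨c', hc', .head ⟨T[i], by simp, h1, rfl⟩ hr⟩
  · rintro ⟨c', rfl, h⟩
    induction h using Relation.ReflTransGen.head_induction_on with
    | refl => exact ⟨[], .nil _⟩
    | head hs _ ih =>
      obtain ⟨w, hw⟩ := ih
      obtain ⟨t, ht, h1, rfl⟩ := hs
      obtain ⟨i, hi, rfl⟩ := List.mem_iff_getElem.1 ht
      refine ⟨(i : ℚ) :: w, .cons (t := T[i].toTransition ⟨i, hi⟩)
        ((List.mem_ofFn' _ _).2 ⟨⟨i, hi⟩, rfl⟩)
        ((affineRAQ_step_iff T y z ⟨i, hi⟩ _ _ _).2 ⟨h1, ?_, rfl⟩) hw⟩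
      -- The letter `i` selects move `i`: the thresholds are `0, 1, 2, …`, so `i` is the first one
      -- that is at least `i`.
      rw [selectGuard_holds]
      exact ⟨le_rfl, fun j hj => not_le.2 (Nat.cast_lt.2 hj)⟩

theorem affineRAQ_output_eval (T : List AffineMove) (y z : ℚ) (c : AffineConfig)
    (h : (affineConfig T y z c).state ∈ (affineRAQ T y z).F) :
    ((affineRAQ T y z).ζ ⟨_, h⟩).eval (affineConfig T y z c).x (affineConfig T y z c).y =
      c.2.1 := by
  have key : (⟨0, ![1, 0], 0⟩ : OutputExpr T.length 2).eval (fun i => ((i : ℕ) : ℚ))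
      ![c.2.1, c.2.2] = c.2.1 := by
    simp [OutputExpr.eval, dotProduct, Fin.sum_univ_two]
  exact key

theorem affineRAQ_outputsZero_iff (T : List AffineMove) (y z : ℚ) :
    (affineRAQ T y z).OutputsZero ↔
      ∃ z', Relation.ReflTransGen (AffineStep T) (0, y, z) (1, 0, z') := by
  have hrun := affineRAQ_run_iff T y z (0, y, z)
  constructor
  · rintro ⟨w, C, hC, h, h0⟩
    obtain ⟨c, rfl, hc⟩ := (hrun C).1 ⟨w, hC⟩
    obtain ⟨s, y', z'⟩ := c
    have hs : s = 1 := Finset.mem_singleton.1 h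
    have hy : y' = 0 := (h0.trans (affineRAQ_output_eval T y z _ h)).symm
    subst hs hy
    exact ⟨z', hc⟩
  · rintro ⟨z', h⟩
    obtain ⟨w, hw⟩ := (hrun (affineConfig T y z (1, 0, z'))).2 ⟨_, rfl, h⟩
    exact ⟨w, _, hw, Finset.mem_singleton_self _, (affineRAQ_output_eval T y z (1, 0, z') _).symm⟩

/-! ### Post normal systems as affine systems -/

/-- One step `u w ⇒ w v` of the Post normal system with the rules `R`. -/
def PostStep {S : Type*} (R : List (List S × List S)) (W W' : List S) : Prop :=
  ∃ r ∈ R, ∃ w, W = r.1 ++ w ∧ W' = w ++ r.2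

/-- The value of a word in base `p`, the first letter being the least significant digit. -/
def wordVal {S : Type*} (p : ℕ) (e : S → ℕ) (w : List S) : ℕ := Nat.ofDigits p (w.map e)

theorem wordVal_append {S : Type*} (p : ℕ) (e : S → ℕ) (u w : List S) :
    wordVal p e (u ++ w) = wordVal p e u + p ^ u.length * wordVal p e w := by
  simp [wordVal, Nat.ofDigits_append]

/-- Reducing modulo `p ^ |u|` leaves the value of the first `|u|` letters of `W`, and digits of a
fixed number of places are determined by their value. The quotient `m` is only assumed to be an
integer, as this is all that the backward argument provides. -/
theorem eq_append_of_wordVal_eq {S : Type*} {p : ℕ} {e : S → ℕ} (hp : 1 < p)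
    (he : Function.Injective e) (hlt : ∀ s, e s < p) {u W : List S} (hl : u.length ≤ W.length)
    {m : ℤ} (h : (wordVal p e W : ℤ) = wordVal p e u + (p : ℤ) ^ u.length * m) :
    ∃ w, W = u ++ w ∧ m = wordVal p e w := by
  have hlt' : ∀ w : List S, wordVal p e w < p ^ w.length := fun w => by
    have := Nat.ofDigits_lt_base_pow_length (b := p) (l := w.map e) hp (by simp [hlt])
    simpa [wordVal] using this
  have htl : (W.take u.length).length = u.length := by simpa using hl
  have hW : wordVal p e W =
      wordVal p e (W.take u.length) + p ^ u.length * wordVal p e (W.drop u.length) := by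
    conv_lhs => rw [← List.take_append_drop u.length W]
    rw [wordVal_append, htl]
  have hmod : wordVal p e (W.take u.length) = wordVal p e u := by
    have h1 := hlt' (W.take u.length)
    have h2 := hlt' u
    rw [htl] at h1
    rw [hW] at h
    push_cast at h
    have h3 : ((wordVal p e (W.take u.length) : ℕ) : ℤ) ≡ (wordVal p e u : ℕ)
        [ZMOD ((p ^ u.length : ℕ) : ℤ)] := by
      refine (Int.modEq_iff_dvd).2 ⟨wordVal p e (W.drop u.length) - m, ?_⟩
      push_cast
      linear_combination -h
    exact Nat.ModEq.eq_of_lt_of_lt (Int.natCast_modEq_iff.1 h3) h1 h2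
  have heq : W.take u.length = u := by
    refine he.list_map ?_
    refine Nat.ofDigits_inj_of_len_eq hp (by simpa using hl) ?_ ?_ hmod
    · simp only [List.mem_map]; rintro _ ⟨a, -, rfl⟩; exact hlt a
    · simp only [List.mem_map]; rintro _ ⟨a, -, rfl⟩; exact hlt a
  refine ⟨W.drop u.length, ?_, ?_⟩
  · conv_lhs => rw [← List.take_append_drop u.length W, heq]
  · have hp0 : (p : ℤ) ^ u.length ≠ 0 := by positivity
    rw [hW, hmod] at h
    push_cast at h
    exact mul_left_cancel₀ hp0 (by linarith)

section PostMoves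

variable {S : Type*} (p : ℕ) (e : S → ℕ)

/-- The move that carries out the rule `u w ⇒ w v`. -/
def ruleMove (r : List S × List S) : AffineMove :=
  ⟨0, 0, 1 / (p : ℚ) ^ r.1.length, wordVal p e r.2 / (p : ℚ) ^ r.1.length,
    -wordVal p e r.1 / (p : ℚ) ^ r.1.length, (p : ℚ) ^ r.2.length / (p : ℚ) ^ r.1.length⟩

/-- The move that leads to the second state after checking that the word starts with `u`. -/
def finishMove (u : List S) : AffineMove :=
  ⟨0, 1, 1 / (p : ℚ) ^ u.length, 0, -wordVal p e u / (p : ℚ) ^ u.length, 1⟩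

/-- The affine system that searches for a word which is reachable by the rules `R` and starts with
a word of `G`. -/
def postMoves (R : List (List S × List S)) (G : List (List S)) : List AffineMove :=
  R.map (ruleMove p e) ++ (G.map (finishMove p e) ++ [⟨1, 1, 1, 0, -1, 1⟩])

variable {p e} {R : List (List S × List S)} {G : List (List S)} {K : ℕ}

theorem affineStep_postMoves_iff (c c' : AffineConfig) : AffineStep (postMoves p e R G) c c' ↔
    (∃ r ∈ R, c.1 = 0 ∧ c' = (0, (c.2.1 - wordVal p e r.1) / (p : ℚ) ^ r.1.length +
        c.2.2 / (p : ℚ) ^ r.1.length * wordVal p e r.2,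
        c.2.2 * (p : ℚ) ^ r.2.length / (p : ℚ) ^ r.1.length)) ∨
    (∃ u ∈ G, c.1 = 0 ∧ c' = (1, (c.2.1 - wordVal p e u) / (p : ℚ) ^ u.length, c.2.2)) ∨
    (c.1 = 1 ∧ c' = (1, c.2.1 - 1, c.2.2)) := by
  simp only [AffineStep, postMoves, List.mem_append, List.mem_map, List.mem_singleton, or_and_right,
    exists_or, ruleMove, finishMove]
  refine or_congr ?_ (or_congr ?_ ?_)
  · constructor
    · rintro ⟨_, ⟨r, hr, rfl⟩, h, rfl⟩
      exact ⟨r, hr, h, by simp only [Prod.mk.injEq, true_and]; constructor <;> ring⟩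
    · rintro ⟨r, hr, h, rfl⟩
      exact ⟨_, ⟨r, hr, rfl⟩, h, by simp only [Prod.mk.injEq, true_and]; constructor <;> ring⟩
  · constructor
    · rintro ⟨_, ⟨r, hr, rfl⟩, h, rfl⟩
      exact ⟨r, hr, h, by simp only [Prod.mk.injEq, true_and]; constructor <;> ring⟩
    · rintro ⟨r, hr, h, rfl⟩
      exact ⟨_, ⟨r, hr, rfl⟩, h, by simp only [Prod.mk.injEq, true_and]; constructor <;> ring⟩
  · constructor
    · rintro ⟨_, rfl, h, rfl⟩
      exact ⟨h, by simp only [Prod.mk.injEq, true_and]; constructor <;> ring⟩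
    · rintro ⟨h, rfl⟩
      exact ⟨_, rfl, h, by simp only [Prod.mk.injEq, true_and]; constructor <;> ring⟩

/-- Every Post step is matched by its move. Finally, the value left after removing `u` is a natural
number, so counting down reaches `0`. -/
theorem postMoves_complete (hp : 1 < p) {W W' u : List S}
    (h : Relation.ReflTransGen (PostStep R) W W') (hu : u ∈ G) (hpre : u <+: W') :
    ∃ z, Relation.ReflTransGen (AffineStep (postMoves p e R G))
      (0, wordVal p e W, (p : ℚ) ^ W.length) (1, 0, z) := by
  have hp0 : (p : ℚ) ≠ 0 := by positivity
  have hcount : ∀ (m : ℕ) (z : ℚ), Relation.ReflTransGen (AffineStep (postMoves p e R G))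
      (1, m, z) (1, 0, z) := by
    intro m z
    induction m with
    | zero => simpa using .refl
    | succ m ih =>
      refine .head ((affineStep_postMoves_iff _ _).2 (.inr (.inr ⟨rfl, ?_⟩))) ih
      simp
  induction h using Relation.ReflTransGen.head_induction_on with
  | refl =>
    obtain ⟨w, rfl⟩ := hpre
    refine ⟨(p : ℚ) ^ (u ++ w).length,
      .head ((affineStep_postMoves_iff _ _).2 (.inr (.inl ⟨u, hu, rfl, ?_⟩)))
        (hcount (wordVal p e w) _)⟩
    simp only [Prod.mk.injEq, true_and, and_true]
    simp only [wordVal_append]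
    push_cast
    field_simp
    ring
  | head hs _ ih =>
    obtain ⟨z, hz⟩ := ih
    obtain ⟨r, hr, w, rfl, rfl⟩ := hs
    refine ⟨z, .head ((affineStep_postMoves_iff _ _).2 (.inl ⟨r, hr, rfl, ?_⟩)) hz⟩
    simp only [wordVal_append, List.length_append, Prod.mk.injEq, true_and]
    push_cast
    constructor
    · field_simp
      ring
    · field_simp
      ring

/-- The induction runs backwards from the end, because integrality of `y` is known only there.
Integrality is claimed for every `y` in the first state, encoding a word or not: the successor has
to be known to be an integer before it can be recognised as the value of a word. -/
theorem postMoves_sound (hp : 1 < p) (he : Function.Injective e) (hlt : ∀ s, e s < p)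
    (hR : ∀ r ∈ R, r.1.length ≤ r.2.length ∧ r.1.length ≤ K) (hG : ∀ u ∈ G, u.length ≤ K)
    {c : AffineConfig} {z : ℚ}
    (h : Relation.ReflTransGen (AffineStep (postMoves p e R G)) c (1, 0, z)) :
    (c.1 = 1 → ∃ m : ℤ, c.2.1 = m) ∧ (c.1 = 0 → ∀ N ≥ K, c.2.2 = (p : ℚ) ^ N →
      (∃ m : ℤ, c.2.1 = m) ∧ ∀ W : List S, W.length = N → c.2.1 = wordVal p e W →
        ∃ W', Relation.ReflTransGen (PostStep R) W W' ∧ ∃ u ∈ G, u <+: W') := by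
  have hp0 : (p : ℚ) ≠ 0 := by positivity
  induction h using Relation.ReflTransGen.head_induction_on with
  | refl => exact ⟨fun _ => ⟨0, by simp⟩, fun h => absurd h (by simp)⟩
  | @head c c' hs _ ih =>
    obtain ⟨q, y, L⟩ := c
    rcases (affineStep_postMoves_iff _ _).1 hs with ⟨r, hr, h0, rfl⟩ | ⟨u, hu, h0, rfl⟩ | ⟨h1, rfl⟩
    · simp only at h0
      subst h0
      refine ⟨fun h => absurd h (by simp), fun _ N hN hL => ?_⟩
      obtain ⟨hr1, hr2⟩ := hR r hr
      simp only at hL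
      subst hL
      -- Here `k = N - |u|` is the length of the remaining word. As `|u| ≤ |v|`, the new length `k +
      -- |v|` is again at least `K`.
      obtain ⟨k, rfl⟩ := Nat.exists_eq_add_of_le (hr2.trans hN)
      have hk : K ≤ k + r.2.length := by omega
      obtain ⟨⟨m, hm⟩, hW⟩ := ih.2 rfl _ hk (by simp only; rw [pow_add, pow_add]; field_simp)
      simp only at hm hW
      -- The move solved for `y`. The term `p ^ k * val v` is an integer since `k` is a natural
      -- number; this is why words must not be shorter than `K`.
      have hy : y = ((wordVal p e r.1 + (p : ℤ) ^ r.1.length *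
          (m - p ^ k * wordVal p e r.2) : ℤ) : ℚ) := by
        push_cast
        rw [← hm, pow_add]
        field_simp
        ring
      refine ⟨⟨_, hy⟩, fun W hWl hWv => ?_⟩
      simp only at hWv
      rw [hWv] at hy
      obtain ⟨w, rfl, hw⟩ := eq_append_of_wordVal_eq hp he hlt (u := r.1) (W := W) (by omega)
        (Int.cast_injective (α := ℚ) hy)
      have hwl : w.length = k := by simpa using hWl
      obtain ⟨W', hW', hG'⟩ := hW (w ++ r.2) (by simp [hwl]) (by
        rw [hm, wordVal_append, hwl]
        push_cast
        have : (m : ℚ) - p ^ k * wordVal p e r.2 = wordVal p e w := by exact_mod_cast hw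
        linarith)
      exact ⟨W', .head ⟨r, hr, w, rfl, rfl⟩ hW', hG'⟩
    · simp only at h0
      subst h0
      refine ⟨fun h => absurd h (by simp), fun _ N hN hL => ?_⟩
      obtain ⟨m, hm⟩ := ih.1 rfl
      simp only at hm
      have hy : y = ((wordVal p e u + (p : ℤ) ^ u.length * m : ℤ) : ℚ) := by
        push_cast
        rw [← hm]
        field_simp
        ring
      refine ⟨⟨_, hy⟩, fun W hWl hWv => ?_⟩
      simp only at hWv
      rw [hWv] at hy
      obtain ⟨w, rfl, -⟩ := eq_append_of_wordVal_eq hp he hlt (u := u) (W := W)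
        (by have := hG u hu; omega) (Int.cast_injective (α := ℚ) hy)
      exact ⟨_, .refl, u, hu, List.prefix_append _ _⟩
    · simp only at h1
      subst h1
      refine ⟨fun _ => ?_, fun h => absurd h (by simp)⟩
      obtain ⟨m, hm⟩ := ih.1 rfl
      exact ⟨m + 1, by push_cast; rw [← hm]; simp⟩

end PostMoves

theorem affineRAQ_postMoves_outputsZero_iff {S : Type*} {p : ℕ} {e : S → ℕ} (hp : 1 < p)
    (he : Function.Injective e) (hlt : ∀ s, e s < p) {R : List (List S × List S)}
    {G : List (List S)} {K : ℕ} (hR : ∀ r ∈ R, r.1.length ≤ r.2.length ∧ r.1.length ≤ K)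
    (hG : ∀ u ∈ G, u.length ≤ K) {W : List S} (hW : K ≤ W.length) :
    (affineRAQ (postMoves p e R G) (wordVal p e W : ℕ) (p ^ W.length : ℕ)).OutputsZero ↔
      ∃ W', Relation.ReflTransGen (PostStep R) W W' ∧ ∃ u ∈ G, u <+: W' := by
  rw [affineRAQ_outputsZero_iff, Nat.cast_pow]
  constructor
  · rintro ⟨z, hz⟩
    exact (((postMoves_sound hp he hlt hR hG hz).2 rfl _ hW rfl).2) W rfl rfl
  · rintro ⟨W', h, u, hu, hpre⟩
    exact postMoves_complete hp h hu hpre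

/-! ### Turing machines as Post normal systems -/

open Turing in
/-- The rules of the Post normal system of a Turing machine.  Its letters are the tape symbols
`some (.inl a)`, the states `some (.inr q)` and a marker `none`. -/
inductive TMRule {Γ Λ : Type} [Inhabited Γ] [Inhabited Λ] (M : TM0.Machine Γ Λ) :
    List (Option (Γ ⊕ Λ)) → List (Option (Γ ⊕ Λ)) → Prop
  | rotate (s) : TMRule M [s] [s]
  | pad : TMRule M [none] [some (.inl default), none, some (.inl default)]
  | write {q a q' c} : M q a = some (q', .write c) →
      TMRule M [some (.inr q), some (.inl a)] [some (.inr q'), some (.inl c)]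
  | right {q a q'} : M q a = some (q', .move .right) →
      TMRule M [some (.inr q), some (.inl a)] [some (.inl a), some (.inr q')]
  | left {q a q'} (b) : M q a = some (q', .move .left) →
      TMRule M [some (.inl b), some (.inr q), some (.inl a)]
        [some (.inr q'), some (.inl b), some (.inl a)]

open Turing in
/-- The words that make a Turing machine halt. -/
inductive TMFinal {Γ Λ : Type} [Inhabited Λ] (M : TM0.Machine Γ Λ) :
    List (Option (Γ ⊕ Λ)) → Prop
  | mk {q a} : M q a = none → TMFinal M [some (.inr q), some (.inl a)]

/-! ### Rotations of words -/

/-- A nontrivial rotation of `y :: l'` starts with a letter of `l'`. Applied to the state letter or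
to the marker, each of which occurs once in a configuration word, this fixes the rotation. -/
theorem List.IsRotated.eq_of_notMem_tail {α : Type*} {x y : α} {l l' : List α}
    (h : (x :: l) ~r (y :: l')) (hx : x ∉ l') : x = y ∧ l = l' := by
  obtain ⟨n, -, hn⟩ := List.isRotated_iff_mod.1 h.symm
  rw [List.rotate_eq_drop_append_take_mod] at hn
  rcases hm : n % (y :: l').length with _ | m
  · rw [hm] at hn
    simp only [List.drop_zero, List.take_zero, List.append_nil, List.cons.injEq] at hn
    exact ⟨hn.1.symm, hn.2.symm⟩
  · exfalso
    have hlt : m + 1 < (y :: l').length := hm ▸ Nat.mod_lt _ (by simp)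
    rw [hm, List.drop_succ_cons] at hn
    have hne : l'.drop m ≠ [] := by
      intro h0
      rw [List.drop_eq_nil_iff] at h0
      simp only [List.length_cons] at hlt
      omega
    obtain ⟨z, t, hz⟩ := List.exists_cons_of_ne_nil hne
    rw [hz] at hn
    simp only [List.cons_append, List.cons.injEq] at hn
    refine hx (List.mem_of_mem_drop (i := m) ?_)
    rw [hz, hn.1]
    exact List.mem_cons_self

theorem isRotated_of_eq_append {α : Type*} {A B X Y : List α} (hA : A = X ++ Y) (hB : B = Y ++ X) :
    A ~r B := by
  rw [hA, hB]
  exact List.isRotated_append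

/-! ### Configurations as cyclic words, and the simulation in both directions -/

section TMPost

open Turing Relation

variable {Γ Λ : Type}

/-- The word of a configuration with the tape contents `L.reverse` to the left of the head and `R`
to the right, beginning with the scanned cell. -/
def tmWord (q : Λ) (L R : List Γ) : List (Option (Γ ⊕ Λ)) :=
  some (.inr q) :: (R.map (fun a => some (.inl a)) ++ none :: L.reverse.map fun a => some (.inl a))

theorem tmWord_isRotated_mark (q : Λ) (L R : List Γ) : (tmWord q L R) ~r
    (none :: (L.reverse.map (fun a => some (.inl a)) ++
      some (.inr q) :: R.map fun a => some (.inl a))) :=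
  isRotated_of_eq_append (X := some (.inr q) :: R.map fun a => some (.inl a)) rfl rfl

theorem tmWord_isRotated_left (q : Λ) (b : Γ) (L R : List Γ) : (tmWord q (b :: L) R) ~r
    (some (.inl b) :: tmWord q L R) :=
  isRotated_of_eq_append (X := tmWord q L R) (Y := [some (.inl b)]) (by simp [tmWord]) rfl

theorem state_notMem_tmWord_tail (q : Λ) (L R : List Γ) :
    some (.inr q) ∉ (R.map (fun a => some (.inl a)) ++
      none :: L.reverse.map fun a => some (.inl a) : List (Option (Γ ⊕ Λ))) := by
  simp

theorem tmWord_eq_of_isRotated {q q' : Λ} {L R : List Γ} {w : List (Option (Γ ⊕ Λ))}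
    (h : (some (.inr q') :: w) ~r tmWord q L R) :
    q' = q ∧ w = R.map (fun a => some (.inl a)) ++ none :: L.reverse.map fun a => some (.inl a) := by
  obtain ⟨h1, h2⟩ := h.eq_of_notMem_tail (state_notMem_tmWord_tail q' L R)
  exact ⟨by simpa using h1, h2⟩

/-- A word that starts with a state and a tape symbol represents only configurations in this
state that scan this symbol. -/
theorem tmWord_eq_of_isRotated_cons {q q' : Λ} {a : Γ} {L R : List Γ}
    {w : List (Option (Γ ⊕ Λ))}
    (h : (some (.inr q') :: some (.inl a) :: w) ~r tmWord q L R) :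
    q' = q ∧ ∃ R', R = a :: R' ∧
      w = R'.map (fun a => some (.inl a)) ++ none :: L.reverse.map fun a => some (.inl a) := by
  obtain ⟨rfl, h2⟩ := tmWord_eq_of_isRotated h
  cases R with
  | nil => simp at h2
  | cons a' R' =>
    simp only [List.map_cons, List.cons_append, List.cons.injEq, Option.some.injEq,
      Sum.inl.injEq] at h2
    exact ⟨rfl, R', by rw [h2.1], h2.2⟩

variable [Inhabited Γ]

/-- The word represents the configuration. -/
def TMRep (W : List (Option (Γ ⊕ Λ))) (c : TM0.Cfg Γ Λ) : Prop :=
  ∃ L R : List Γ, c.Tape = Tape.mk' (ListBlank.mk L) (ListBlank.mk R) ∧ W ~r tmWord c.q L R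

theorem ListBlank.mk_append_default (l : List Γ) :
    ListBlank.mk (l ++ [default]) = ListBlank.mk l :=
  Quotient.sound (Or.inr ⟨1, rfl⟩)

theorem Tape.write_mk'_cons (a s : Γ) (L : ListBlank Γ) (R : List Γ) :
    (Tape.mk' L (ListBlank.mk (a :: R))).write s = Tape.mk' L (ListBlank.mk (s :: R)) := by
  simp [Tape.write_mk']

variable [Inhabited Λ] {M : TM0.Machine Γ Λ} {P : List (List (Option (Γ ⊕ Λ)) × List (Option (Γ ⊕ Λ)))}

theorem postStep_of_rule (hP : ∀ u v, (u, v) ∈ P ↔ TMRule M u v) {u v}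
    (h : TMRule M u v) (w) : PostStep P (u ++ w) (w ++ v) :=
  ⟨(u, v), (hP u v).2 h, w, rfl, rfl⟩

theorem postStep_reflTransGen_of_isRotated (hP : ∀ u v, (u, v) ∈ P ↔ TMRule M u v)
    {W X : List (Option (Γ ⊕ Λ))} (h : W ~r X) : ReflTransGen (PostStep P) W X := by
  obtain ⟨n, rfl⟩ := h
  induction n generalizing W with
  | zero => simpa using .refl
  | succ n ih =>
    cases W with
    | nil => simpa using .refl
    | cons s w =>
      rw [List.rotate_cons_succ]
      exact .head (postStep_of_rule hP (.rotate s) w) ih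

/-- Rotating the marker to the front and padding adds a blank at both ends of the tape. The scanned
cell and its left neighbour then occur in the word, as the rules for moves require. -/
theorem exists_padded (hP : ∀ u v, (u, v) ∈ P ↔ TMRule M u v) {W : List (Option (Γ ⊕ Λ))}
    {c : TM0.Cfg Γ Λ} (h : TMRep W c) : ∃ a b L R,
      c.Tape = Tape.mk' (ListBlank.mk (b :: L)) (ListBlank.mk (a :: R)) ∧
      ReflTransGen (PostStep P) W (tmWord c.q (b :: L) (a :: R)) := by
  obtain ⟨L, R, hT, hW⟩ := h
  have h1 := postStep_reflTransGen_of_isRotated hP (hW.trans (tmWord_isRotated_mark c.q L R))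
  have h2 := h1.tail (postStep_of_rule hP .pad _)
  have h3 : (L.reverse.map (fun a => some (.inl a)) ++
      some (.inr c.q) :: R.map fun a => some (.inl a)) ++
      [some (.inl default), none, some (.inl default)] ~r
      tmWord c.q (L ++ [default]) (R ++ [default]) := by
    exact isRotated_of_eq_append (X := L.reverse.map fun a => some (.inl a))
      (Y := some (.inr c.q) :: (R.map (fun a => some (.inl a)) ++
        [some (.inl default), none, some (.inl default)])) (by simp) (by simp [tmWord])
  have h4 := h2.trans (postStep_reflTransGen_of_isRotated hP h3)
  rw [← ListBlank.mk_append_default L, ← ListBlank.mk_append_default R] at hT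
  obtain ⟨b, L', hL⟩ := List.exists_cons_of_ne_nil (show L ++ [default] ≠ [] by simp)
  obtain ⟨a, R', hR⟩ := List.exists_cons_of_ne_nil (show R ++ [default] ≠ [] by simp)
  rw [hL, hR] at h4 hT
  exact ⟨a, b, L', R', hT, h4⟩

theorem TMRep.step (hP : ∀ u v, (u, v) ∈ P ↔ TMRule M u v) {W : List (Option (Γ ⊕ Λ))}
    {c c' : TM0.Cfg Γ Λ} (h : TMRep W c) (hc : c' ∈ TM0.step M c) :
    ∃ W', ReflTransGen (PostStep P) W W' ∧ TMRep W' c' := by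
  obtain ⟨a, b, L, R, hT, hW⟩ := exists_padded hP h
  obtain ⟨q, T⟩ := c
  simp only at hT hW
  subst hT
  simp only [TM0.step, Tape.mk'_head, ListBlank.head_mk, List.headI_cons, Option.mem_def,
    Option.map_eq_some_iff] at hc
  obtain ⟨⟨q', s⟩, hM, rfl⟩ := hc
  rcases s with (_ | _) | s
  · refine ⟨_, (hW.trans (postStep_reflTransGen_of_isRotated hP
      (tmWord_isRotated_left q b L (a :: R)))).tail (postStep_of_rule hP (.left b hM) _),
      L, b :: a :: R, ?_, ?_⟩
    · simp [Tape.move_left_mk']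
    · exact isRotated_of_eq_append rfl (by simp [tmWord])
  · refine ⟨_, hW.tail (postStep_of_rule hP (.right hM) _), a :: b :: L, R, ?_, ?_⟩
    · simp [Tape.move_right_mk']
    · exact isRotated_of_eq_append
        (X := R.map (fun a => some (.inl a)) ++ none :: (a :: b :: L).reverse.map
          fun a => some (.inl a)) (Y := [some (.inr q')]) (by simp) rfl
  · refine ⟨_, hW.tail (postStep_of_rule hP (.write hM) _), b :: L, s :: R, ?_, ?_⟩
    · exact Tape.write_mk'_cons a s _ R
    · exact isRotated_of_eq_append rfl (by simp [tmWord])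

/-- The system is nondeterministic, but no choice does harm: rotating and padding keep the
configuration, and any other applicable rule carries out the step of the machine. -/
theorem TMRep.postStep (hP : ∀ u v, (u, v) ∈ P ↔ TMRule M u v) {W W' : List (Option (Γ ⊕ Λ))}
    {c : TM0.Cfg Γ Λ} (h : TMRep W c) (hW : PostStep P W W') :
    ∃ c', TM0.Reaches M c c' ∧ TMRep W' c' := by
  obtain ⟨⟨u, v⟩, hr, w, rfl, rfl⟩ := hW
  obtain ⟨L, R, hT, hrot⟩ := h
  obtain ⟨q, T⟩ := c
  simp only at hT hrot
  subst hT
  cases (hP u v).1 hr with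
  | rotate s => exact ⟨_, .refl, L, R, rfl, List.isRotated_append.trans hrot⟩
  | pad =>
    have h1 := (hrot.trans (tmWord_isRotated_mark q L R)).eq_of_notMem_tail (by simp)
    refine ⟨_, .refl, L ++ [default], R ++ [default], ?_, ?_⟩
    · simp only [ListBlank.mk_append_default]
    · rw [show w = _ from h1.2]
      exact isRotated_of_eq_append (X := L.reverse.map fun a => some (.inl a))
        (Y := some (.inr q) :: (R.map (fun a => some (.inl a)) ++
          [some (.inl default), none, some (.inl default)])) (by simp) (by simp [tmWord])
  | @write _ a q' s hM =>
    obtain ⟨rfl, R, rfl, rfl⟩ := tmWord_eq_of_isRotated_cons hrot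
    refine ⟨⟨q', (Tape.mk' (ListBlank.mk L) (ListBlank.mk (a :: R))).write s⟩,
      .single (by simp [TM0.step, hM]), L, s :: R, ?_, ?_⟩
    · exact Tape.write_mk'_cons a s _ R
    · exact isRotated_of_eq_append rfl (by simp [tmWord])
  | @right _ a q' hM =>
    obtain ⟨rfl, R, rfl, rfl⟩ := tmWord_eq_of_isRotated_cons hrot
    refine ⟨⟨q', (Tape.mk' (ListBlank.mk L) (ListBlank.mk (a :: R))).move .right⟩,
      .single (by simp [TM0.step, hM]), a :: L, R, ?_, ?_⟩
    · simp [Tape.move_right_mk']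
    · exact isRotated_of_eq_append
        (X := R.map (fun a => some (.inl a)) ++ none :: (a :: L).reverse.map
          fun a => some (.inl a)) (Y := [some (.inr q')]) (by simp) rfl
  | @left p a q' b hM =>
    -- Rotating `b` to the end brings the state to the front, which fixes the rotation. If `L` were
    -- empty, the last letter would be the marker and not `b`.
    have hrot' : (some (.inr p) :: some (.inl a) :: (w ++ [some (.inl b)])) ~r tmWord q L R :=
      List.IsRotated.trans (isRotated_of_eq_append (X := some (.inr p) :: some (.inl a) :: w)
        (Y := [some (.inl b)]) rfl rfl) hrot
    obtain ⟨rfl, R, rfl, hw⟩ := tmWord_eq_of_isRotated_cons hrot'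
    cases L with
    | nil =>
      have := congrArg List.getLast? hw
      simp at this
    | cons b' L =>
      have hw' : w ++ [some (.inl b)] =
          (R.map (fun a => some (.inl a)) ++ none :: L.reverse.map fun a => some (.inl a)) ++
            [some (.inl b')] := by simpa using hw
      obtain ⟨rfl, hb⟩ := List.append_inj' hw' rfl
      obtain rfl : b = b' := by simpa using hb
      refine ⟨⟨q', (Tape.mk' (ListBlank.mk (b :: L)) (ListBlank.mk (a :: R))).move .left⟩,
        .single (by simp [TM0.step, hM]), L, b :: a :: R, ?_, ?_⟩
      · simp [Tape.move_left_mk']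
      · exact isRotated_of_eq_append rfl (by simp [tmWord])

theorem post_reaches_final_iff (hP : ∀ u v, (u, v) ∈ P ↔ TMRule M u v)
    {G : List (List (Option (Γ ⊕ Λ)))} (hG : ∀ u, u ∈ G ↔ TMFinal M u)
    {W : List (Option (Γ ⊕ Λ))} {c : TM0.Cfg Γ Λ} (h : TMRep W c) :
    (∃ W', ReflTransGen (PostStep P) W W' ∧ ∃ u ∈ G, u <+: W') ↔
      (StateTransition.eval (TM0.step M) c).Dom := by
  constructor
  · rintro ⟨W', hW, u, hu, hpre⟩
    obtain ⟨c', hc, hrep⟩ : ∃ c', TM0.Reaches M c c' ∧ TMRep W' c' := by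
      clear hpre
      induction hW with
      | refl => exact ⟨c, .refl, h⟩
      | tail _ hs ih =>
        obtain ⟨c', hc, hrep⟩ := ih
        obtain ⟨c'', hc', hrep'⟩ := hrep.postStep hP hs
        exact ⟨c'', hc.trans hc', hrep'⟩
    obtain ⟨L, R, hT, hrot⟩ := hrep
    obtain ⟨w, rfl⟩ := hpre
    obtain ⟨hM⟩ := (hG u).1 hu
    obtain ⟨rfl, R, rfl, -⟩ := tmWord_eq_of_isRotated_cons hrot
    refine Part.dom_iff_mem.2 ⟨c', StateTransition.mem_eval.2 ⟨hc, ?_⟩⟩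
    obtain ⟨q, T⟩ := c'
    simp only at hT
    subst hT
    simpa [TM0.step] using hM
  · intro hd
    obtain ⟨c', hc⟩ := Part.dom_iff_mem.1 hd
    obtain ⟨hr, hn⟩ := StateTransition.mem_eval.1 hc
    obtain ⟨W', hW, hrep⟩ : ∃ W', ReflTransGen (PostStep P) W W' ∧ TMRep W' c' := by
      clear hn hc
      induction hr with
      | refl => exact ⟨W, .refl, h⟩
      | tail _ hs ih =>
        obtain ⟨W', hW, hrep⟩ := ih
        obtain ⟨W'', hW', hrep'⟩ := hrep.step hP hs
        exact ⟨W'', hW.trans hW', hrep'⟩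
    -- Without padding, the state might be followed by the marker, and no final word would be a
    -- prefix.
    obtain ⟨a, b, L, R, hT, hW'⟩ := exists_padded hP hrep
    obtain ⟨q, T⟩ := c'
    simp only at hT
    subst hT
    refine ⟨_, hW.trans hW', [some (.inr q), some (.inl a)], (hG _).2 ⟨?_⟩, ?_⟩
    · simpa [TM0.step] using hn
    · simp [tmWord]

/-- Rules and final words can be listed because they consist of words of length at most `3` over a
finite alphabet. -/
theorem exists_postSystem [Finite Γ] [Finite Λ] (M : TM0.Machine Γ Λ) :
    ∃ (P : List (List (Option (Γ ⊕ Λ)) × List (Option (Γ ⊕ Λ))))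
      (G : List (List (Option (Γ ⊕ Λ)))),
      (∀ r ∈ P, r.1.length ≤ r.2.length ∧ r.1.length ≤ 3) ∧ (∀ u ∈ G, u.length ≤ 3) ∧
      ∀ W c, TMRep W c → ((∃ W', ReflTransGen (PostStep P) W W' ∧ ∃ u ∈ G, u <+: W') ↔
        (StateTransition.eval (TM0.step M) c).Dom) := by
  have hf := List.finite_length_le (Option (Γ ⊕ Λ)) 3
  have hP : {r : List (Option (Γ ⊕ Λ)) × List (Option (Γ ⊕ Λ)) | TMRule M r.1 r.2}.Finite := by
    refine (hf.prod hf).subset ?_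
    rintro ⟨u, v⟩ (h : TMRule M u v)
    cases h <;> simp
  have hG : {u | TMFinal M u}.Finite := by
    refine hf.subset ?_
    rintro _ ⟨⟩
    simp
  refine ⟨hP.toFinset.toList, hG.toFinset.toList, ?_, ?_, fun W c h =>
    post_reaches_final_iff (fun u v => by simp) (fun u => by simp) h⟩
  · rintro ⟨u, v⟩ h
    have h' : TMRule M u v := by simpa using h
    cases h' <;> simp
  · intro u h
    have h' : TMFinal M u := by simpa using h
    cases h'
    simp

end TMPost

/-! ### A universal machine -/

section Universal

open Turing StateTransition

/-- The machine never leaves a supporting set of states, so the states outside can be collapsed to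
the default one. States become letters of the Post system, hence there must be finitely many. -/
theorem exists_finite_TM0_of_supports {Γ Λ : Type} [Inhabited Γ] [Inhabited Λ]
    (M : TM0.Machine Γ Λ) {S : Finset Λ} (hS : TM0.Supports M ↑S) :
    ∃ (Λ' : Type) (_ : Inhabited Λ') (_ : Finite Λ') (M' : TM0.Machine Γ Λ'), ∀ l : List Γ,
      (eval (TM0.step M') (TM0.init l)).Dom ↔ (eval (TM0.step M) (TM0.init l)).Dom := by
  classical
  let _ : Inhabited S := ⟨⟨default, hS.1⟩⟩
  let f : PointedMap Γ Γ := ⟨id, rfl⟩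
  let g : PointedMap Λ S := ⟨fun q => if h : q ∈ S then ⟨q, h⟩ else default, by
    rw [dif_pos (show default ∈ S from hS.1)]
    rfl⟩
  refine ⟨S, inferInstance, inferInstance, M.map f f g Subtype.val, fun l => ?_⟩
  refine tr_eval_dom (TM0.Machine.map_respects M f f g Subtype.val hS (fun _ => rfl) ?_)
    ⟨hS.1, ?_⟩
  · intro q hq
    have : q ∈ S := hq
    simp [g, this]
  · rw [TM0.map_init]
    congr 1
    exact List.map_id l

theorem exists_TM0_of_TM2 {K : Type} [DecidableEq K] {Γ : K → Type} {Λ σ : Type} [Inhabited Λ] [Inhabited σ] [Fintype σ]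
    (M : Λ → TM2.Stmt Γ Λ σ) {S : Finset Λ} (hS : TM2.Supports M S) :
    ∃ (Λ' : Type) (_ : Inhabited Λ') (_ : Finite Λ') (M' : TM0.Machine (TM2to1.Γ' K Γ) Λ'),
      ∀ k (L : List (Γ k)), (eval (TM0.step M') (TM0.init (TM2to1.trInit k L))).Dom ↔
        (eval (TM2.step M) (TM2.init k L)).Dom := by
  obtain ⟨Λ', i, hfin, M', h⟩ := exists_finite_TM0_of_supports _
    (TM1to0.tr_supports (TM2to1.tr M) (TM2to1.tr_supports M hS))
  refine ⟨Λ', i, hfin, M', fun k L => ?_⟩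
  rw [h, ← tr_eval_dom (TM2to1.tr_respects M) (TM2to1.trCfg_init k L)]
  exact tr_eval_dom (TM1to0.tr_respects (TM2to1.tr M)) rfl

theorem trNat_eq_bits_map (n : ℕ) : PartrecToTM2.trNat n =
    n.bits.map fun b => if b then PartrecToTM2.Γ'.bit1 else PartrecToTM2.Γ'.bit0 := by
  induction n using Nat.binaryRec' with
  | zero => simp
  | bit b n h ih =>
    have hb : ((Nat.bit b n : ℕ) : Num) = cond b Num.bit1 Num.bit0 (n : Num) := by
      rw [← Num.ofNat'_eq, Num.ofNat'_bit, Num.ofNat'_eq]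
    rw [Nat.bits_append_bit _ _ h, List.map_cons, ← ih, PartrecToTM2.trNat, PartrecToTM2.trNat, hb]
    cases hn : (n : Num) with
    | zero =>
      have h0 : n = 0 := by
        have := congrArg (fun m : Num => (m : ℕ)) hn
        simpa using this
      cases b
      · simp [h0] at h
      · rfl
    | pos m => cases b <;> rfl

theorem trInit_eq_of_reverse_eq {K : Type} [DecidableEq K] {Γ : K → Type} (k : K) {L : List (Γ k)}
    {β : Type} {x : Γ k} {l : List β} {g : β → Γ k} (h : L.reverse = x :: l.map g) :
    TM2to1.trInit k L =
      ((true, Function.update (fun _ => none) k (some x)) : TM2to1.Γ' K Γ) ::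
        l.map fun b => ((false, Function.update (fun _ => none) k (some (g b))) :
          TM2to1.Γ' K Γ) := by
  rw [TM2to1.trInit, h]
  exact congrArg (List.cons _) List.map_map

instance : Fintype PartrecToTM2.K' :=
  ⟨{.main, .rev, .aux, .stack}, fun k => by cases k <;> simp⟩

/-- The partial function that sends the number of a code to its value at `0` is partial recursive,
so one machine computes it. The explicit form of the input tape makes the later reduction
computable. -/
theorem exists_universal_TM0 : ∃ (Γ Λ : Type) (_ : Inhabited Γ) (_ : Inhabited Λ)
    (_ : Finite Γ) (_ : Finite Λ) (M : TM0.Machine Γ Λ) (a : Γ) (b : Bool → Γ),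
    ∀ c : Nat.Partrec.Code,
      (eval (TM0.step M) (TM0.init (a :: (Encodable.encode c).bits.reverse.map b))).Dom ↔
        (c.eval 0).Dom := by
  have hf : Partrec fun n : ℕ => (Denumerable.ofNat Nat.Partrec.Code n).eval 0 :=
    Nat.Partrec.Code.eval_part.comp (Computable.ofNat _) (Computable.const 0)
  obtain ⟨u, hu⟩ := ToPartrec.Code.exists_code (Nat.Partrec'.part_iff₁.2 hf)
  -- `TM2.init` starts at the default label, so the first label of the program for `u` is made the
  -- default.
  obtain ⟨Λ, i, hfin, M, hM⟩ := @exists_TM0_of_TM2 _ _ _ _ _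
    ⟨PartrecToTM2.trNormal u PartrecToTM2.Cont'.halt⟩ _ _ _ _ (PartrecToTM2.tr_supports u .halt)
  refine ⟨_, Λ, inferInstance, i, inferInstance, hfin, M, (true, Function.update (fun _ => none)
    PartrecToTM2.K'.main (some .cons)), fun b => (false, Function.update (fun _ => none)
    PartrecToTM2.K'.main (some (if b then .bit1 else .bit0))), fun c => ?_⟩
  have h1 := hM PartrecToTM2.K'.main (PartrecToTM2.trList [Encodable.encode c])
  have h2 : @TM2.init _ _ _ _ ⟨PartrecToTM2.trNormal u PartrecToTM2.Cont'.halt⟩ _ _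
      PartrecToTM2.K'.main (PartrecToTM2.trList [Encodable.encode c]) =
      PartrecToTM2.init u [Encodable.encode c] := by
    simp only [TM2.init, PartrecToTM2.init]
    congr 1
    funext k
    cases k <;> rfl
  have h3 : (eval (TM2.step PartrecToTM2.tr) (PartrecToTM2.init u [Encodable.encode c])).Dom ↔
      (c.eval 0).Dom := by
    rw [PartrecToTM2.tr_eval]
    have := hu ⟨[Encodable.encode c], rfl⟩
    simp only [] at this
    rw [this]
    simp [List.Vector.head]
  rw [h2, h3] at h1
  have h4 : (PartrecToTM2.trList [Encodable.encode c]).reverse =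
      .cons :: (Encodable.encode c).bits.reverse.map fun b => if b then .bit1 else .bit0 := by
    simp [trNat_eq_bits_map]
  rw [trInit_eq_of_reverse_eq _ h4] at h1
  exact h1

end Universal

/-! ### Computability of the reduction -/

theorem primrec_intCast : Primrec ((↑) : ℕ → ℤ) :=
  -- The encoding of `ℤ` sends a natural number `n` to `2 * n`.
  Primrec.encode_iff.1 (Primrec.nat_double.of_eq fun _ => rfl)

theorem primrec_bits : Primrec Nat.bits := by
  -- In the strong recursion, `l` lists the values at all smaller arguments, so its length is the
  -- current argument and the entry at half of it is the tail of the bits.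
  have hg : Primrec₂ fun (_ : Unit) (l : List (List Bool)) =>
      if l.length = 0 then some [] else (l[l.length.div2]?).map (List.cons l.length.bodd) := by
    have hlen : Primrec fun x : Unit × List (List Bool) => x.2.length :=
      Primrec.list_length.comp .snd
    refine Primrec.ite (Primrec.eq.comp hlen (.const 0)) (.const _) ?_
    exact Primrec.option_map (Primrec.list_getElem?.comp .snd (Primrec.nat_div2.comp hlen))
      (Primrec.list_cons.comp (Primrec.nat_bodd.comp (hlen.comp .fst)) .snd).to₂
  have h := Primrec.nat_strong_rec (fun (_ : Unit) n => n.bits) hg fun _ n => by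
    by_cases hn : n = 0
    · simp [hn]
    · have hlt : n.div2 < n := by rw [Nat.div2_val]; omega
      have hb : Nat.bit n.bodd n.div2 = n := Nat.bit_bodd_div2 n
      have h := Nat.bits_append_bit n.div2 n.bodd (fun h0 => by
        rw [h0] at hb
        by_contra hc
        rw [Bool.not_eq_true] at hc
        rw [hc] at hb
        exact hn hb.symm)
      rw [hb] at h
      simp [hn, hlt, h]
  exact h.comp (.const ()) .id

theorem primrec_ofDigits (p : ℕ) : Primrec fun l : List ℕ => Nat.ofDigits p l := by
  have : Primrec fun l : List ℕ => l.foldr (fun a b => a + p * b) 0 :=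
    Primrec.list_foldr .id (.const 0)
      (Primrec.nat_add.comp (Primrec.fst.comp .snd)
        (Primrec.nat_mul.comp (.const p) (Primrec.snd.comp .snd))).to₂
  exact this.of_eq fun l => (Nat.ofDigits_eq_foldr p l).symm

theorem primrec_pow (p : ℕ) : Primrec fun n : ℕ => p ^ n := by
  have : Primrec fun n : ℕ => (Nat.rec 1 (fun _ m => m * p) n : ℕ) :=
    Primrec.nat_rec₁ 1 (Primrec.nat_mul.comp .snd (.const p)).to₂
  refine this.of_eq fun n => ?_
  induction n with
  | zero => rfl
  | succ n ih => rw [pow_succ, ← ih]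

/-- Only the initial contents of the data variables depend on the parameter. -/
theorem computable_affineRAQ_code (T : List AffineMove) {α : Type*} [Primcodable α]
    {y z : α → ℕ} (hy : Computable y) (hz : Computable z) :
    Computable fun a => (affineRAQ T (y a) (z a)).code := by
  have hc : ∀ {f : α → ℕ}, Computable f → Computable fun a => ratCode (f a) := fun {f} hf => by
    refine ((primrec_intCast.to_comp.comp hf).pair (Computable.const 1)).of_eq fun a => ?_
    simp [ratCode]
  have hvec : Computable fun a => [ratCode (y a), ratCode (z a)] :=
    Computable.list_cons.comp (hc hy) (Computable.list_cons.comp (hc hz) (.const []))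
  refine ((Computable.const (affineRAQ T 0 0).code.1).pair
    ((Computable.const (affineRAQ T 0 0).code.2.1).pair
    ((Computable.const (affineRAQ T 0 0).code.2.2.1).pair
    ((Computable.const (affineRAQ T 0 0).code.2.2.2.1).pair
    ((Computable.const (affineRAQ T 0 0).code.2.2.2.2.1).pair
    (hvec.pair (Computable.const (affineRAQ T 0 0).code.2.2.2.2.2.2))))))).of_eq fun a => rfl

theorem exists_computable_reduction : ∃ A : Nat.Partrec.Code → RAQ,
    (Computable fun c => (A c).code) ∧ (∀ c, (A c).Deterministic) ∧
      ∀ c, (A c).OutputsZero ↔ (c.eval 0).Dom := by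
  obtain ⟨Γ, Λ, _, _, _, _, M, a, b, hM⟩ := exists_universal_TM0
  obtain ⟨P, G, hP, hG, hPG⟩ := exists_postSystem M
  obtain ⟨n, ⟨e⟩⟩ := Finite.exists_equiv_fin (Option (Γ ⊕ Λ))
  let W : Nat.Partrec.Code → List (Option (Γ ⊕ Λ)) := fun c =>
    tmWord default [] (a :: (Encodable.encode c).bits.reverse.map b)
  let d : Option (Γ ⊕ Λ) → ℕ := fun s => e s
  have hWd : Computable fun c => (W c).map d := by
    have h1 : Computable fun c : Nat.Partrec.Code =>
        (Encodable.encode c).bits.reverse.map fun x => d (some (.inl (b x))) :=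
      ((Primrec.list_map .id ((Primrec.dom_finite fun x => d (some (.inl (b x)))).comp
        .snd).to₂).comp (Primrec.list_reverse.comp (primrec_bits.comp .encode))).to_comp
    have h2 := Computable.list_cons.comp (.const (d (some (.inr default))))
      (Computable.list_cons.comp (.const (d (some (.inl a))))
        (Computable.list_append.comp h1 (.const [d none])))
    refine h2.of_eq fun c => ?_
    simp [W, tmWord, Function.comp_def]
  refine ⟨fun c => affineRAQ (postMoves (n + 2) d P G) (wordVal (n + 2) d (W c) : ℕ)
    ((n + 2) ^ (W c).length : ℕ), ?_, fun c => affineRAQ_deterministic _ _ _, fun c => ?_⟩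
  · refine computable_affineRAQ_code _ ((primrec_ofDigits _).to_comp.comp hWd) ?_
    refine ((primrec_pow (n + 2)).to_comp.comp (Computable.list_length.comp hWd)).of_eq fun c => ?_
    simp
  -- The base `n + 2` exceeds `1` and all digits, which lie below `n`. The initial word has at least
  -- `K = 3` letters: the state, `a` and the marker.
  · refine (affineRAQ_postMoves_outputsZero_iff (p := n + 2) (e := d) (K := 3) (W := W c)
      (by omega) (Fin.val_injective.comp e.injective) (fun s => ?_) hP hG ?_).trans
      ((hPG _ _ ⟨[], a :: (Encodable.encode c).bits.reverse.map b, rfl, .refl _⟩).trans (hM c))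
    · exact (e s).isLt.trans (by omega)
    · simp [W, tmWord]

/-- All automata of the reduction are deterministic, so on their codes the algorithm halts with the
right answer. Composed with the reduction, it would decide the halting problem. -/
theorem RAQ.not_decidableOn {𝒞 : RAQ → Prop} (h : ∀ 𝒜 : RAQ, 𝒜.Deterministic → 𝒞 𝒜) :
    ¬ RAQ.DecidableOn 𝒞 RAQ.OutputsZero := by
  rintro ⟨f, hf, hdec⟩
  obtain ⟨A, hA, hdet, hhalt⟩ := exists_computable_reduction
  classical
  refine ComputablePred.halting_problem 0 ⟨Classical.decPred _, ?_⟩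
  refine (hf.comp hA).of_eq fun c => ?_
  obtain ⟨b, hb, hiff⟩ := hdec (A c) (h _ (hdet c))
  rw [Part.eq_some_iff.2 hb]
  refine congrArg Part.some ?_
  rw [Bool.eq_iff_iff, hiff, hhalt, decide_eq_true_iff]

theorem mainTheorem6 :
    ¬ RAQ.DecidableOn (fun _ => True) RAQ.OutputsZero ∧
      ¬ RAQ.DecidableOn RAQ.Deterministic RAQ.OutputsZero :=
  ⟨RAQ.not_decidableOn fun _ _ => trivial, RAQ.not_decidableOn fun _ h => h⟩
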